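/- All spaces are completely regular and Hausdorff. A space is \emph{realcompact} if it is homeomorphic to a closed subspace of a product of copies of the real line. For a space $X$, let $\beta X$ be its Stone--\v{C}ech compactification (with $X\subseteq\beta X$), and let $\upsilon X\subseteq\beta X$ be its Hewitt realcompactification, that is, the intersection of all cozero-sets of $\beta X$ containing $X$. An \emph{extension} of $X$ is a space $T$ containing $X$ as a dense subspace; two extensions of $X$ are identified if there is a homeomorphism between them fixing $X$ pointwise. Let $\mathscr{R}(X)$ be the set of all (equivalence classes of) extensions $T$ of $X$ such that $T$ is realcompact and $T\setminus X$ is compact, partially ordered by: $S\leq T$ if there is a continuous map $T\to S$ fixing $X$ pointwise. \textbf{Theorem.} Let $X$ and $Y$ be locally compact non-realcompact spaces. If $\mathscr{R}(X)$ and $\mathscr{R}(Y)$ are order-isomorphic, then $(\beta X\setminus X)\setminus\mathrm{cl}_{\beta X}(\upsilon X\setminus X)$ and $(\beta Y\setminus Y)\setminus\mathrm{cl}_{\beta Y}(\upsilon Y\setminus Y)$ are homeomorphic. -/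

import Mathlib

open Set Topology

universe u v

namespace CompactRemainder

section Spaces

variable (X : Type u) [TopologicalSpace X]

/-- A space is realcompact if it is homeomorphic to a closed subspace of a product of copies of
the real line. -/
def IsRealcompact : Prop :=
  ∃ (ι : Type u) (e : X → ι → ℝ), IsClosedEmbedding e

/-- The canonical copy of `X` in its Stone–Čech compactification `βX`. -/
def betaImage : Set (StoneCech X) :=
  range stoneCechUnit

/-- The Hewitt realcompactification `υX`, as a subset of `βX`: the intersection of all
cozero-sets `{p | g p ≠ 0}` of `βX` that contain `X`. See `isRealcompact_upsilon` and
`exists_extend_upsilon` for its characteristic properties. -/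
def upsilon : Set (StoneCech X) :=
  ⋂₀ {C | (∃ g : C(StoneCech X, ℝ), C = {p | g p ≠ 0}) ∧ betaImage X ⊆ C}

/-- The closure in `βX` of `υX ∖ X`. -/
def clUpsilonDiff : Set (StoneCech X) :=
  closure (upsilon X \ betaImage X)

/-- The subset `(βX ∖ X) ∖ cl_{βX}(υX ∖ X)` of `βX`. -/
def outerRemainder : Set (StoneCech X) :=
  (betaImage X)ᶜ \ clUpsilonDiff X

end Spaces

section Hewitt

variable {X : Type u} [TopologicalSpace X]

theorem mem_upsilon {p : StoneCech X} :
    p ∈ upsilon X ↔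
      ∀ g : C(StoneCech X, ℝ), (∀ x : X, g (stoneCechUnit x) ≠ 0) → g p ≠ 0 := by
  constructor
  · intro h g hg
    exact h {p | g p ≠ 0} ⟨⟨g, rfl⟩, by rintro _ ⟨x, rfl⟩; exact hg x⟩
  · rintro h C ⟨⟨g, rfl⟩, hC⟩
    exact h g fun x => hC ⟨x, rfl⟩

theorem betaImage_subset_upsilon : betaImage X ⊆ upsilon X := by
  rintro _ ⟨x, rfl⟩
  exact mem_upsilon.2 fun g hg => hg x

variable (X) in
/-- `υX` is realcompact. -/
theorem isRealcompact_upsilon : IsRealcompact (upsilon X) := by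
  let G := {g : C(StoneCech X, ℝ) // ∀ x : X, g (stoneCechUnit x) ≠ 0}
  let E : StoneCech X → C(StoneCech X, ℝ) → ℝ := fun p f => f p
  have hEc : Continuous E := continuous_pi fun f => f.continuous
  have hEi : Function.Injective E := by
    intro p q hpq
    by_contra hne
    obtain ⟨f, hf, hfne⟩ := separatesPoints_continuous_of_t35Space (X := StoneCech X) hne
    exact hfne (congrFun hpq ⟨f, hf⟩)
  have hE : IsClosedEmbedding E := hEc.isClosedEmbedding hEi
  let e : upsilon X → C(StoneCech X, ℝ) ⊕ G → ℝ :=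
    fun p => Sum.elim (fun f => f p.1) (fun g => (g.1 p.1)⁻¹)
  have hec : Continuous e := by
    refine continuous_pi fun i => ?_
    rcases i with f | g
    · exact f.continuous.comp continuous_subtype_val
    · exact (g.1.continuous.comp continuous_subtype_val).inv₀
        fun p => mem_upsilon.1 p.2 g.1 g.2
  have hr : Continuous fun z : C(StoneCech X, ℝ) ⊕ G → ℝ =>
      fun f : C(StoneCech X, ℝ) => z (Sum.inl f) :=
    continuous_pi fun f => continuous_apply _
  refine ⟨C(StoneCech X, ℝ) ⊕ G, e, ?_, ?_⟩
  · exact IsEmbedding.of_comp hec hr (hE.isEmbedding.comp IsEmbedding.subtypeVal)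
  · have : range e = {z | (fun f => z (Sum.inl f)) ∈ range E} ∩
        ⋂ g : G, {z | z (Sum.inl g.1) * z (Sum.inr g) = 1} := by
      ext z
      simp only [mem_inter_iff, mem_ofPred_eq, mem_iInter]
      constructor
      · rintro ⟨p, rfl⟩
        exact ⟨⟨p.1, rfl⟩, fun g => mul_inv_cancel₀ (mem_upsilon.1 p.2 g.1 g.2)⟩
      · rintro ⟨⟨p, hp⟩, hz⟩
        have hp' : ∀ f : C(StoneCech X, ℝ), z (Sum.inl f) = f p :=
          fun f => (congrFun hp f).symm
        have hpu : p ∈ upsilon X := mem_upsilon.2 fun g hg h0 => by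
          have := hz ⟨g, hg⟩
          rw [hp', h0, zero_mul] at this
          exact zero_ne_one this
        refine ⟨⟨p, hpu⟩, ?_⟩
        funext i
        rcases i with f | g
        · exact (hp' f).symm
        · have := hz g
          rw [hp'] at this
          exact (eq_inv_of_mul_eq_one_right this).symm
    rw [this]
    refine (hE.isClosed_range.preimage hr).inter (isClosed_iInter fun g => ?_)
    exact isClosed_eq (by fun_prop) continuous_const

/-- Every continuous real-valued function on `X` extends continuously to `υX`. -/
theorem exists_extend_real (f : X → ℝ) (hf : Continuous f) :
    ∃ F : upsilon X → ℝ, Continuous F ∧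
      ∀ x : X, F ⟨stoneCechUnit x, betaImage_subset_upsilon ⟨x, rfl⟩⟩ = f x := by
  let h : OnePoint ℝ → ℝ := fun z => z.elim 0 fun t : ℝ => (1 + t ^ 2)⁻¹
  have hh : Continuous h := by
    rw [OnePoint.continuous_iff]
    constructor
    · change Filter.Tendsto (fun t : ℝ => (1 + t ^ 2)⁻¹) _ (𝓝 0)
      rw [Filter.coclosedCompact_eq_cocompact]
      refine Filter.Tendsto.inv_tendsto_atTop ?_
      refine Filter.tendsto_atTop_add_const_left _ _ ?_
      have : (fun t : ℝ => t ^ 2) = fun t : ℝ => ‖t‖ ^ 2 := by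
        funext t; simp
      rw [this]
      exact (Filter.tendsto_pow_atTop two_ne_zero).comp (tendsto_norm_cocompact_atTop (E := ℝ))
    · change Continuous fun t : ℝ => (1 + t ^ 2)⁻¹
      exact Continuous.inv₀ (by fun_prop) fun t => by positivity
  have hg : Continuous fun x => (f x : OnePoint ℝ) := OnePoint.continuous_coe.comp hf
  have hFc := continuous_stoneCechExtend hg
  have hne : ∀ p : upsilon X, stoneCechExtend hg p.1 ≠ OnePoint.infty := by
    intro p hp
    refine mem_upsilon.1 p.2 ⟨fun q => h (stoneCechExtend hg q), hh.comp hFc⟩ ?_ ?_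
    · intro x
      simp only [ContinuousMap.coe_mk, stoneCechExtend_stoneCechUnit]
      change (1 + f x ^ 2)⁻¹ ≠ 0
      positivity
    · simp only [ContinuousMap.coe_mk, hp]
      rfl
  choose F hF using fun p => OnePoint.ne_infty_iff_exists.1 (hne p)
  refine ⟨F, ?_, fun x => ?_⟩
  · rw [OnePoint.isOpenEmbedding_coe.isEmbedding.continuous_iff]
    exact (hFc.comp continuous_subtype_val).congr fun p => (hF p).symm
  · exact OnePoint.coe_injective ((hF _).trans (stoneCechExtend_stoneCechUnit hg x))

/-- Every continuous map of `X` to a realcompact space extends continuously to `υX`. -/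
theorem exists_extend_upsilon {Z : Type v} [TopologicalSpace Z] (hZ : IsRealcompact Z)
    (f : X → Z) (hf : Continuous f) :
    ∃ F : upsilon X → Z, Continuous F ∧
      ∀ x : X, F ⟨stoneCechUnit x, betaImage_subset_upsilon ⟨x, rfl⟩⟩ = f x := by
  obtain ⟨ι, e, he⟩ := hZ
  choose F hFc hF using fun i =>
    exists_extend_real (fun x => e (f x) i)
      ((continuous_apply i).comp (he.continuous.comp hf))
  have hc : Continuous fun (p : upsilon X) i => F i p := continuous_pi hFc
  have hdense : DenseRange fun x : X =>
      (⟨stoneCechUnit x, betaImage_subset_upsilon ⟨x, rfl⟩⟩ : upsilon X) := by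
    intro p
    rw [closure_subtype, ← range_comp]
    exact denseRange_stoneCechUnit p.1
  have hmem : ∀ p : upsilon X, (fun i => F i p) ∈ range e := by
    intro p
    refine hdense.induction_on (p := fun p => (fun i => F i p) ∈ range e) p
      (he.isClosed_range.preimage hc) fun x => ⟨f x, ?_⟩
    funext i
    exact (hF i x).symm
  choose H hH using hmem
  refine ⟨H, ?_, fun x => he.injective ?_⟩
  · rw [he.isEmbedding.continuous_iff]
    exact hc.congr fun p => (hH p).symm
  · rw [hH]
    funext i
    exact hF i x

end Hewitt

section Extensions

/-- A (completely regular, Hausdorff) extension of `X`: a space containing `X` as a dense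
subspace. -/
structure Extension (X : Type u) [TopologicalSpace X] where
  carrier : Type u
  [top : TopologicalSpace carrier]
  [t35 : T35Space carrier]
  incl : X → carrier
  isDenseEmbedding : IsDenseEmbedding incl

attribute [instance] Extension.top Extension.t35

variable {X : Type u} [TopologicalSpace X]

namespace Extension

/-- The remainder `T ∖ X` of an extension `T` of `X`. -/
def remainder (T : Extension X) : Set T.carrier :=
  (range T.incl)ᶜ

/-- `S ≤ T`: there is a continuous map from `T` to `S` which fixes `X` pointwise. -/
def LE (S T : Extension X) : Prop :=
  ∃ f : T.carrier → S.carrier, Continuous f ∧ ∀ x, f (T.incl x) = S.incl x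

/-- `S` and `T` are equivalent: there is a homeomorphism between them which fixes `X`
pointwise. -/
def Equivalent (S T : Extension X) : Prop :=
  ∃ f : S.carrier ≃ₜ T.carrier, ∀ x, f (S.incl x) = T.incl x

theorem LE.rfl' (S : Extension X) : LE S S :=
  ⟨id, continuous_id, fun _ => rfl⟩

theorem LE.trans' {S T U : Extension X} (h : LE S T) (k : LE T U) : LE S U := by
  obtain ⟨f, hf, hfx⟩ := h
  obtain ⟨g, hg, hgx⟩ := k
  exact ⟨f ∘ g, hf.comp hg, fun x => by simp [hgx, hfx]⟩

theorem Equivalent.symm' {S T : Extension X} (h : Equivalent S T) : Equivalent T S := by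
  obtain ⟨f, hf⟩ := h
  exact ⟨f.symm, fun x => by rw [← hf x, f.symm_apply_apply]⟩

theorem Equivalent.ge {S T : Extension X} (h : Equivalent S T) : LE T S := by
  obtain ⟨f, hf⟩ := h
  exact ⟨f, f.continuous, hf⟩

theorem Equivalent.le {S T : Extension X} (h : Equivalent S T) : LE S T :=
  h.symm'.ge

theorem LE.antisymm' {S T : Extension X} (h : LE S T) (k : LE T S) : Equivalent S T := by
  obtain ⟨f, hf, hfx⟩ := h
  obtain ⟨g, hg, hgx⟩ := k
  have h1 : f ∘ g = id :=
    S.isDenseEmbedding.dense.equalizer (hf.comp hg) continuous_id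
      (funext fun x => by simp [hgx, hfx])
  have h2 : g ∘ f = id :=
    T.isDenseEmbedding.dense.equalizer (hg.comp hf) continuous_id
      (funext fun x => by simp [hgx, hfx])
  exact ⟨⟨⟨g, f, congrFun h1, congrFun h2⟩, hg, hf⟩, hgx⟩

variable (X) in
/-- Equivalence of extensions. -/
instance setoid : Setoid (Extension X) where
  r := Equivalent
  iseqv :=
    ⟨fun _ => ⟨Homeomorph.refl _, fun _ => rfl⟩, fun h => h.symm',
      fun h k => (LE.trans' h.le k.le).antisymm' (LE.trans' k.ge h.ge)⟩

end Extension

/-- The equivalence classes of extensions of `X`. -/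
def ExtensionClass (X : Type u) [TopologicalSpace X] : Type (u + 1) :=
  Quotient (Extension.setoid X)

/-- The partial order on (equivalence classes of) extensions induced by `Extension.LE`. -/
instance : PartialOrder (ExtensionClass X) where
  le a b := Quotient.liftOn₂ a b Extension.LE fun _ _ _ _ h k =>
    propext ⟨fun l => (h.ge.trans' l).trans' k.le, fun l => (h.le.trans' l).trans' k.ge⟩
  le_refl a := Quotient.inductionOn a Extension.LE.rfl'
  le_trans a b c := Quotient.inductionOn₃ a b c fun _ _ _ h k => Extension.LE.trans' h k
  le_antisymm a b := Quotient.inductionOn₂ a b fun _ _ h k =>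
    Quotient.sound (Extension.LE.antisymm' h k)

/-- `ℛ(X)`: the set of all (equivalence classes of) realcompactifications of `X` with compact
remainder, that is, of realcompact extensions `T` of `X` with `T ∖ X` compact. It is partially
ordered as a subset of `ExtensionClass X`. -/
def realcompactifications (X : Type u) [TopologicalSpace X] : Set (ExtensionClass X) :=
  {a | ∃ T : Extension X, a = Quotient.mk _ T ∧ IsRealcompact T.carrier ∧ IsCompact T.remainder}

end Extensions

end CompactRemainder

/-! Write L for the closure of υX ∖ X in βX. An element T of ℛ(X) is encoded by two data on βX, read
off from the surjection βX → βT: its core, which is the preimage of the remainder, and the pairs of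
points it identifies. The core is closed, misses X and contains L (`clUpsilonDiff_subset_core`).
Local compactness of X forces distinct identified points into the core (`mem_core_of_betaMap_eq`).
Going down in the order means enlarging the core and identifying more (`LE_iff`). Conversely, every
closed C with L ⊆ C ⊆ βX ∖ X is a core, with no identification or with one prescribed pair of its
points glued (`exists_realcompactification`).

Hence X ∪ L is the greatest element, and there are two kinds of coatoms: add one point p of the
outer remainder (`point`), or glue two points of L. The order separates them: gluing p to a point of
L gives an element below the coatom of p and no other, whereas anything strictly below a coatom of
the second kind lies below a further coatom (`isPointLike_point`, `exists_eq_point`). An order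
isomorphism thus matches the points of the outer remainders. It is a homeomorphism because the
closed sets are the sets `{p | x ≤ point hX p}`, the traces of the cores
(`isClosed_outerRemainder_iff`). -/

namespace CompactRemainder

/-! ### Dense embeddings -/

section DenseMaps

/-- If `κ` restricts to an embedding `j` of the dense image of `i`, then the only point sent by
`κ` to `j d` is `i d`. -/
theorem eq_of_map_eq_of_isInducing {D W Z : Type*} [TopologicalSpace D] [TopologicalSpace W]
    [TopologicalSpace Z] [T2Space W] {i : D → W} {j : D → Z} {κ : W → Z} (hi : DenseRange i)
    (hic : Continuous i) (hκ : Continuous κ) (hj : IsInducing j) (h : ∀ d, κ (i d) = j d)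
    {w : W} {d : D} (hw : κ w = j d) : w = i d := by
  -- The trace on `D` of the neighbourhoods of `w` is a proper filter; it converges to `d` because
  -- `j` is inducing, so its image tends to both `w` and `i d`.
  have : (Filter.comap i (𝓝 w)).NeBot := Filter.comap_neBot_iff_frequently.2
    (mem_closure_iff_frequently.1 (hi w))
  have t1 : Filter.Tendsto i (Filter.comap i (𝓝 w)) (𝓝 w) := Filter.tendsto_comap
  have t2 : Filter.Tendsto (j ∘ id) (Filter.comap i (𝓝 w)) (𝓝 (j d)) := by
    rw [← hw]
    exact ((hκ.tendsto w).comp t1).congr h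
  have t3 : Filter.Tendsto id (Filter.comap i (𝓝 w)) (𝓝 d) := hj.tendsto_nhds_iff.2 t2
  exact tendsto_nhds_unique t1 ((hic.tendsto d).comp t3)

/-- A locally compact dense subspace of a Hausdorff space is open. -/
theorem isOpen_range_of_isDenseEmbedding {D W : Type*} [TopologicalSpace D]
    [TopologicalSpace W] [LocallyCompactSpace D] [T2Space W] {i : D → W}
    (hi : IsDenseEmbedding i) : IsOpen (range i) := by
  rw [isOpen_iff_mem_nhds]
  rintro _ ⟨x, rfl⟩
  obtain ⟨K, hK, hxK⟩ := exists_compact_mem_nhds x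
  rw [hi.isInducing.nhds_eq_comap, Filter.mem_comap] at hxK
  obtain ⟨V, hV, hVK⟩ := hxK
  obtain ⟨O, hOV, hO, hxO⟩ := mem_nhds_iff.1 hV
  refine Filter.mem_of_superset (hO.mem_nhds hxO) ?_
  have h1 : O ⊆ closure (O ∩ range i) := hi.dense.open_subset_closure_inter hO
  have h2 : O ∩ range i ⊆ i '' K := by
    rintro _ ⟨hy, y, rfl⟩
    exact ⟨y, hVK (hOV hy), rfl⟩
  exact h1.trans ((closure_minimal h2 (hK.image hi.continuous).isClosed).trans
    (image_subset_range _ _))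

end DenseMaps

variable {X : Type u} [TopologicalSpace X]

/-! ### The map βX → βT, its core and its fibres -/

namespace Extension

/-- The canonical map `βX → βT` of an extension `T` of `X`. -/
noncomputable def betaMap (T : Extension X) : StoneCech X → StoneCech T.carrier :=
  stoneCechExtend (continuous_stoneCechUnit.comp T.isDenseEmbedding.continuous)

/-- The preimage of the remainder of `T` under `βX → βT`. -/
def core (T : Extension X) : Set (StoneCech X) :=
  T.betaMap ⁻¹' (stoneCechUnit '' T.remainder)

variable (T : Extension X)

theorem continuous_betaMap : Continuous T.betaMap :=
  continuous_stoneCechExtend _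

theorem betaMap_unit (x : X) : T.betaMap (stoneCechUnit x) = stoneCechUnit (T.incl x) :=
  stoneCechExtend_stoneCechUnit _ x

theorem surjective_betaMap : Function.Surjective T.betaMap := by
  have hd : DenseRange T.betaMap := by
    have h : DenseRange (stoneCechUnit ∘ T.incl : X → StoneCech T.carrier) :=
      denseRange_stoneCechUnit.comp T.isDenseEmbedding.dense continuous_stoneCechUnit
    refine h.mono ?_
    rintro _ ⟨x, rfl⟩
    exact ⟨_, T.betaMap_unit x⟩
  rw [← range_eq_univ, ← (isCompact_range T.continuous_betaMap).isClosed.closure_eq]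
  exact hd.closure_range

variable {T}

theorem eq_unit_of_betaMap_eq {p : StoneCech X} {x : X}
    (h : T.betaMap p = stoneCechUnit (T.incl x)) : p = stoneCechUnit x :=
  eq_of_map_eq_of_isInducing (j := stoneCechUnit ∘ T.incl) denseRange_stoneCechUnit
    continuous_stoneCechUnit T.continuous_betaMap
    (isInducing_stoneCechUnit.comp T.isDenseEmbedding.isInducing) T.betaMap_unit h

theorem core_subset_compl : T.core ⊆ (betaImage X)ᶜ := by
  rintro _ ⟨t, ht, htp⟩ ⟨x, rfl⟩
  rw [T.betaMap_unit] at htp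
  exact ht ⟨x, (injective_stoneCechUnit_of_t35Space htp).symm⟩

theorem betaMap_mem_range_iff {p : StoneCech X} :
    T.betaMap p ∈ range (stoneCechUnit : T.carrier → _) ↔ p ∈ betaImage X ∪ T.core := by
  constructor
  · rintro ⟨t, ht⟩
    by_cases h : t ∈ range T.incl
    · obtain ⟨x, rfl⟩ := h
      exact Or.inl ⟨x, (eq_unit_of_betaMap_eq ht.symm).symm⟩
    · exact Or.inr ⟨t, h, ht⟩
  · rintro (⟨x, rfl⟩ | ⟨t, -, ht⟩)
    · exact ⟨_, (T.betaMap_unit x).symm⟩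
    · exact ⟨t, ht⟩

theorem isClosed_core (hT : IsCompact T.remainder) : IsClosed T.core :=
  (hT.image continuous_stoneCechUnit).isClosed.preimage T.continuous_betaMap

/-- Since `T` is realcompact, X → T extends over υX; by density the extension agrees with βX → βT,
which therefore sends υX into `T`. -/
theorem clUpsilonDiff_subset_core (hr : IsRealcompact T.carrier) (hT : IsCompact T.remainder) :
    clUpsilonDiff X ⊆ T.core := by
  refine closure_minimal ?_ (isClosed_core hT)
  obtain ⟨F, hF, hFx⟩ := exists_extend_upsilon hr T.incl T.isDenseEmbedding.continuous
  have hd : DenseRange fun x : X =>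
      (⟨stoneCechUnit x, betaImage_subset_upsilon ⟨x, rfl⟩⟩ : upsilon X) := by
    intro p
    rw [closure_subtype, ← range_comp]
    exact denseRange_stoneCechUnit p.1
  have hc : (fun p : upsilon X => T.betaMap p.1) = fun p => stoneCechUnit (F p) :=
    hd.equalizer (T.continuous_betaMap.comp continuous_subtype_val)
      (continuous_stoneCechUnit.comp hF) (funext fun x => by
        simp only [Function.comp_apply, hFx, T.betaMap_unit])
  rintro p ⟨hp, hpX⟩
  exact (betaMap_mem_range_iff.1 ⟨_, (congrFun hc ⟨p, hp⟩).symm⟩).resolve_left hpX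

/-- Away from the remainder, functions on βX descend to βT: a function separating `p` from `q`, cut
off near the remainder, is continuous on `T` because X is open in it. -/
theorem mem_core_of_betaMap_eq [LocallyCompactSpace X] (hT : IsCompact T.remainder)
    {p q : StoneCech X} (h : T.betaMap p = T.betaMap q) (hpq : p ≠ q) : p ∈ T.core := by
  by_contra hp
  have hK : IsClosed (stoneCechUnit '' T.remainder : Set (StoneCech T.carrier)) :=
    (hT.image continuous_stoneCechUnit).isClosed
  obtain ⟨U, V, hU, hV, hKU, hpV, hUV⟩ :=
    SeparatedNhds.of_isCompact_isCompact hK.isCompact (isCompact_singleton (x := T.betaMap p))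
      (disjoint_singleton_right.2 hp)
  obtain ⟨g, hg, hg0, hg1⟩ := CompletelyRegularSpace.completely_regular (T.betaMap p) Vᶜ
    hV.isClosed_compl (not_not_intro (hpV rfl))
  obtain ⟨f, hf, hf0, hf1⟩ := CompletelyRegularSpace.completely_regular p {q}
    isClosed_singleton hpq
  -- The factor 1 - g vanishes on `U`, a neighbourhood of the remainder, so the product extends by
  -- 0; at the common image of `p` and `q` this factor is 1.
  let h₀ : T.carrier → unitInterval := fun t =>
    Function.extend T.incl (fun x => f (stoneCechUnit x)) (fun _ => 0) t *
      unitInterval.symm (g (stoneCechUnit t))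
  have hx : ∀ x, h₀ (T.incl x) =
      f (stoneCechUnit x) * unitInterval.symm (g (stoneCechUnit (T.incl x))) := fun x => by
    simp only [h₀, T.isDenseEmbedding.injective.extend_apply]
  have hh₀ : Continuous h₀ := by
    rw [continuous_iff_continuousAt]
    intro t
    by_cases ht : t ∈ range T.incl
    · obtain ⟨x, rfl⟩ := ht
      have ho : IsOpenEmbedding T.incl :=
        ⟨T.isDenseEmbedding.isEmbedding, isOpen_range_of_isDenseEmbedding T.isDenseEmbedding⟩
      rw [← ho.continuousAt_iff]
      have hc : Continuous fun x =>
          f (stoneCechUnit x) * unitInterval.symm (g (stoneCechUnit (T.incl x))) :=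
        (hf.comp continuous_stoneCechUnit).mul (unitInterval.continuous_symm.comp
          (hg.comp (continuous_stoneCechUnit.comp T.isDenseEmbedding.continuous)))
      exact (hc.congr fun x => (hx x).symm).continuousAt
    · refine (continuousAt_const (y := (0 : unitInterval))).congr ?_
      filter_upwards [continuous_stoneCechUnit.continuousAt.preimage_mem_nhds
        (hU.mem_nhds (hKU ⟨t, ht, rfl⟩))] with s hs
      have : g (stoneCechUnit s) = 1 := hg1 fun hsV => hUV.le_bot ⟨hs, hsV⟩
      simp [h₀, this]
  have key : ∀ p', stoneCechExtend hh₀ (T.betaMap p') =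
      f p' * unitInterval.symm (g (T.betaMap p')) := by
    refine congrFun (denseRange_stoneCechUnit.equalizer
      ((continuous_stoneCechExtend hh₀).comp T.continuous_betaMap)
      (hf.mul (unitInterval.continuous_symm.comp (hg.comp T.continuous_betaMap))) ?_)
    funext x
    simp only [Function.comp_apply, betaMap_unit, stoneCechExtend_stoneCechUnit, hx]
  have h1 := key p
  rw [h, key q, ← h, hf0, hf1 rfl, hg0] at h1
  simp at h1

/-- βX → βT is a quotient map, so the second condition factors βX → βS through it; the first
condition makes the factor carry `T` into `S`. -/
theorem LE_iff {S T : Extension X} :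
    LE S T ↔ T.core ⊆ S.core ∧ ∀ p q, T.betaMap p = T.betaMap q → S.betaMap p = S.betaMap q := by
  constructor
  · rintro ⟨f, hf, hfx⟩
    let F := stoneCechExtend (continuous_stoneCechUnit.comp hf)
    have hF : ∀ t, F (stoneCechUnit t) = stoneCechUnit (f t) := stoneCechExtend_stoneCechUnit _
    have hFc : Continuous F := continuous_stoneCechExtend _
    have hc : S.betaMap = F ∘ T.betaMap :=
      denseRange_stoneCechUnit.equalizer S.continuous_betaMap (hFc.comp T.continuous_betaMap)
        (funext fun x => by simp only [Function.comp_apply, betaMap_unit, hF, hfx])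
    refine ⟨fun p hp => ?_, fun p q h => by simp only [hc, Function.comp_apply, h]⟩
    have hpX : p ∉ betaImage X := core_subset_compl hp
    obtain ⟨t, -, ht⟩ := hp
    refine (betaMap_mem_range_iff.1 ?_).resolve_left hpX
    exact ⟨f t, by rw [hc, Function.comp_apply, ← ht, hF]⟩
  · rintro ⟨hC, hE⟩
    have hq : IsQuotientMap T.betaMap :=
      T.continuous_betaMap.isClosedMap.isQuotientMap T.continuous_betaMap T.surjective_betaMap
    have hE' : ∀ p, S.betaMap (Function.surjInv T.surjective_betaMap (T.betaMap p)) =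
        S.betaMap p := fun p => hE _ _ (Function.surjInv_eq _ _)
    let ψ : StoneCech T.carrier → StoneCech S.carrier :=
      fun r => S.betaMap (Function.surjInv T.surjective_betaMap r)
    have hψ : Continuous ψ := hq.continuous_iff.2 (S.continuous_betaMap.congr fun p => (hE' p).symm)
    have hm : ∀ t : T.carrier, ψ (stoneCechUnit t) ∈ range (stoneCechUnit : S.carrier → _) := by
      intro t
      refine betaMap_mem_range_iff.2 ?_
      have : Function.surjInv T.surjective_betaMap (stoneCechUnit t) ∈ betaImage X ∪ T.core :=
        betaMap_mem_range_iff.1 ⟨t, (Function.surjInv_eq _ _).symm⟩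
      exact this.imp_right fun h => hC h
    choose f hf using hm
    refine ⟨f, ?_, fun x => injective_stoneCechUnit_of_t35Space ?_⟩
    · rw [isInducing_stoneCechUnit.continuous_iff]
      exact (hψ.comp continuous_stoneCechUnit).congr fun t => (hf t).symm
    · rw [hf, ← betaMap_unit, ← betaMap_unit]
      exact hE' _

end Extension

/-! ### Gluing two points of βX -/

section Gluing

/-- The continuous map on `βX` which identifies the points `a` and `b` (and no others). -/
def gluing (a b : StoneCech X) (p : StoneCech X) : {f : C(StoneCech X, ℝ) // f a = f b} → ℝ :=
  fun f => f.1 p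

variable {a b : StoneCech X}

theorem continuous_gluing : Continuous (gluing a b) :=
  continuous_pi fun f => f.1.continuous

theorem gluing_left_eq_right : gluing a b a = gluing a b b :=
  funext fun f => f.2

/-- Functions in the index type of `gluing a b` separate points from closed sets away from
`a` and `b`. -/
theorem exists_gluing_index {p : StoneCech X} {K : Set (StoneCech X)} (hK : IsClosed K)
    (hp : p ∉ K) (ha : p ≠ a) (hb : p ≠ b) :
    ∃ f : {f : C(StoneCech X, ℝ) // f a = f b}, f.1 p = 0 ∧ ∀ q ∈ K, f.1 q = 1 := by
  obtain ⟨f, hf, hf0, hf1⟩ := CompletelyRegularSpace.completely_regular p (K ∪ {a, b})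
    (hK.union (toFinite {a, b}).isClosed) (by simp [hp, ha, hb])
  refine ⟨⟨⟨fun q => f q, by fun_prop⟩, ?_⟩, ?_, ?_⟩
  · simp [hf1 (show a ∈ K ∪ {a, b} by simp), hf1 (show b ∈ K ∪ {a, b} by simp)]
  · simp [hf0]
  · intro q hq
    simp [hf1 (Or.inl hq)]

theorem gluing_eq_iff {p q : StoneCech X} :
    gluing a b p = gluing a b q ↔ p = q ∨ (p = a ∧ q = b) ∨ (p = b ∧ q = a) := by
  have key : ∀ p q, gluing a b p = gluing a b q → p ≠ q → p = a ∨ p = b := by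
    intro p q h hpq
    by_contra! hn
    obtain ⟨f, h0, h1⟩ := exists_gluing_index (isClosed_singleton (x := q)) hpq hn.1 hn.2
    have := congrFun h f
    simp only [gluing, h0, h1 q rfl] at this
    exact zero_ne_one this
  constructor
  · intro h
    by_cases hpq : p = q
    · exact Or.inl hpq
    · have h1 := key p q h hpq
      have h2 := key q p h.symm (Ne.symm hpq)
      grind
  · rintro (rfl | ⟨rfl, rfl⟩ | ⟨rfl, rfl⟩)
    · rfl
    · exact gluing_left_eq_right
    · exact gluing_left_eq_right.symm

variable {C : Set (StoneCech X)}

theorem gluing_mem_image_iff (hab : a ∈ C ↔ b ∈ C) {p : StoneCech X} :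
    gluing a b p ∈ gluing a b '' C ↔ p ∈ C := by
  refine ⟨?_, mem_image_of_mem _⟩
  rintro ⟨q, hq, h⟩
  rcases gluing_eq_iff.1 h with rfl | ⟨rfl, rfl⟩ | ⟨rfl, rfl⟩
  · exact hq
  · exact hab.1 hq
  · exact hab.2 hq

variable [T35Space X]

/-- The extension of `X` obtained from the subspace `X ∪ C` of `βX` by identifying two points
`a` and `b` of `C`. -/
def glue (C : Set (StoneCech X)) (a b : StoneCech X) (ha : a ∉ betaImage X)
    (hb : b ∉ betaImage X) : Extension X where
  carrier := gluing a b '' (betaImage X ∪ C)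
  incl x := ⟨gluing a b (stoneCechUnit x), mem_image_of_mem _ (Or.inl ⟨x, rfl⟩)⟩
  t35 := IsEmbedding.subtypeVal.t35Space
  isDenseEmbedding :=
    { dense := by
        intro t
        rw [closure_subtype, ← range_comp]
        obtain ⟨_, p, -, rfl⟩ := t
        have h := image_closure_subset_closure_image (continuous_gluing (a := a) (b := b))
          (mem_image_of_mem _ (denseRange_stoneCechUnit p))
        rwa [← range_comp] at h
      injective := by
        intro x y h
        rcases gluing_eq_iff.1 (congrArg Subtype.val h) with h | ⟨h, -⟩ | ⟨h, -⟩
        · exact injective_stoneCechUnit_of_t35Space h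
        · exact absurd ⟨x, h⟩ ha
        · exact absurd ⟨x, h⟩ hb
      toIsInducing := by
        refine (IsInducing.subtypeVal.of_comp_iff).1 (isInducing_iff_nhds.2 fun x => ?_)
        refine le_antisymm
          ((continuous_gluing.comp continuous_stoneCechUnit).tendsto x).le_comap fun U hU => ?_
        rw [isInducing_stoneCechUnit.nhds_eq_comap, Filter.mem_comap] at hU
        obtain ⟨V, hV, hVU⟩ := hU
        obtain ⟨O, hOV, hO, hxO⟩ := mem_nhds_iff.1 hV
        obtain ⟨f, h0, h1⟩ := exists_gluing_index (a := a) (b := b) hO.isClosed_compl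
          (not_not_intro hxO) (fun h => ha ⟨x, h⟩) (fun h => hb ⟨x, h⟩)
        refine Filter.mem_comap.2 ⟨{z | z f < 1},
          (isOpen_lt (continuous_apply f) continuous_const).mem_nhds ?_, fun y hy => ?_⟩
        · change f.1 (stoneCechUnit x) < 1
          rw [h0]
          exact zero_lt_one
        · by_contra hyU
          have : f.1 (stoneCechUnit y) = 1 := h1 _ fun hyO => hyU (hVU (hOV hyO))
          change f.1 (stoneCechUnit y) < 1 at hy
          exact hy.ne this }

variable {ha : a ∉ betaImage X} {hb : b ∉ betaImage X}

theorem mem_remainder_glue (hC : C ⊆ (betaImage X)ᶜ) (hab : a ∈ C ↔ b ∈ C) (p : StoneCech X)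
    (hp : p ∈ betaImage X ∪ C) :
    (⟨gluing a b p, mem_image_of_mem _ hp⟩ : (glue C a b ha hb).carrier) ∈
      (glue C a b ha hb).remainder ↔ p ∈ C := by
  constructor
  · intro h
    refine hp.resolve_left ?_
    rintro ⟨x, rfl⟩
    exact h ⟨x, rfl⟩
  · rintro h ⟨x, hx⟩
    have hx' : gluing a b (stoneCechUnit x) = gluing a b p := congrArg Subtype.val hx
    exact hC ((gluing_mem_image_iff hab).1 ⟨p, h, hx'.symm⟩) ⟨x, rfl⟩

theorem isCompact_remainder_glue (hC : C ⊆ (betaImage X)ᶜ) (hCc : IsClosed C)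
    (hab : a ∈ C ↔ b ∈ C) : IsCompact (glue C a b ha hb).remainder := by
  have : CompactSpace C := isCompact_iff_compactSpace.1 hCc.isCompact
  let F : C → (glue C a b ha hb).carrier :=
    fun p => ⟨gluing a b p.1, mem_image_of_mem _ (Or.inr p.2)⟩
  have hF : Continuous F := (continuous_gluing.comp continuous_subtype_val).subtype_mk _
  have hrange : (glue C a b ha hb).remainder = range F := by
    refine Set.ext fun t => ?_
    obtain ⟨_, p, hp, rfl⟩ := t
    refine (mem_remainder_glue hC hab p hp).trans ⟨fun h => ⟨⟨p, h⟩, rfl⟩, ?_⟩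
    rintro ⟨q, hq⟩
    exact (gluing_mem_image_iff hab).1 ⟨q, q.2, congrArg Subtype.val hq⟩
  exact hrange ▸ isCompact_range hF

theorem isRealcompact_glue (hL : clUpsilonDiff X ⊆ C) (haC : a ∈ C) (hbC : b ∈ C)
    (hCc : IsClosed C) : IsRealcompact (glue C a b ha hb).carrier := by
  let J := {f : C(StoneCech X, ℝ) // f a = f b}
  let G := {g : J // ∀ p ∈ betaImage X ∪ C, g.1 p ≠ 0}
  let A : Set (J → ℝ) := gluing a b '' (betaImage X ∪ C)
  change IsRealcompact A
  have hne : ∀ (z : A) (g : G), z.1 g.1 ≠ 0 := by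
    rintro ⟨_, p, hp, rfl⟩ g
    exact g.2 p hp
  let e : A → J ⊕ G → ℝ := fun z => Sum.elim (fun f => z.1 f) (fun g => (z.1 g.1)⁻¹)
  have hec : Continuous e := by
    refine continuous_pi fun i => ?_
    rcases i with f | g
    · exact (continuous_apply f).comp continuous_subtype_val
    · exact ((continuous_apply g.1).comp continuous_subtype_val).inv₀ fun z => hne z g
  have hr : Continuous fun (z : J ⊕ G → ℝ) (f : J) => z (Sum.inl f) :=
    continuous_pi fun f => continuous_apply _
  refine ⟨J ⊕ G, e, IsEmbedding.of_comp hec hr IsEmbedding.subtypeVal, ?_⟩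
  have hrange : range e = {z | (fun f => z (Sum.inl f)) ∈ range (gluing a b)} ∩
      ⋂ g : G, {z | z (Sum.inl g.1) * z (Sum.inr g) = 1} := by
    ext z
    simp only [mem_inter_iff, mem_ofPred_eq, mem_iInter]
    constructor
    · rintro ⟨t, rfl⟩
      obtain ⟨p, -, hp⟩ := t.2
      exact ⟨⟨p, hp⟩, fun g => mul_inv_cancel₀ (hne t g)⟩
    · rintro ⟨⟨p, hp⟩, hz⟩
      have hp' : ∀ f : J, z (Sum.inl f) = f.1 p := fun f => (congrFun hp f).symm
      have hpA : p ∈ betaImage X ∪ C := by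
        by_contra hn
        have hpC : p ∉ C := fun h => hn (Or.inr h)
        have hpu : p ∉ upsilon X := fun h => hpC (hL (subset_closure ⟨h, fun h => hn (Or.inl h)⟩))
        rw [mem_upsilon] at hpu
        push Not at hpu
        obtain ⟨g, hg, hgp⟩ := hpu
        obtain ⟨f, hf, hf0, hf1⟩ := CompletelyRegularSpace.completely_regular p C hCc hpC
        -- Being constantly 1 on `C`, `k` descends to the quotient; it vanishes at `p` but nowhere
        -- on X ∪ C, so its reciprocal coordinate excludes `p`.
        let k : C(StoneCech X, ℝ) := ⟨fun q => min 1 (|g q| + f q), by fun_prop⟩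
        have hkC : ∀ q ∈ C, k q = 1 := by
          intro q hq
          simp [k, hf1 hq]
        have hkX : ∀ q ∈ betaImage X ∪ C, k q ≠ 0 := by
          rintro q (⟨x, rfl⟩ | hq)
          · have h1 : 0 < |g (stoneCechUnit x)| := abs_pos.2 (hg x)
            have h2 : (0 : ℝ) ≤ f (stoneCechUnit x) := (f _).2.1
            exact (lt_min one_pos (by linarith)).ne'
          · rw [hkC q hq]
            exact one_ne_zero
        have := hz ⟨⟨k, by rw [hkC a haC, hkC b hbC]⟩, hkX⟩
        rw [hp'] at this
        simp [k, hgp, hf0] at this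
      refine ⟨⟨gluing a b p, mem_image_of_mem _ hpA⟩, ?_⟩
      funext i
      rcases i with f | g
      · exact (hp' f).symm
      · have := hz g
        rw [hp'] at this
        exact (eq_inv_of_mul_eq_one_right this).symm
  rw [hrange]
  refine ((isCompact_range continuous_gluing).isClosed.preimage hr).inter
    (isClosed_iInter fun g => ?_)
  exact isClosed_eq (by fun_prop) continuous_const

/-- The Stone–Čech compactification of `glue C a b` maps onto the quotient of `βX`. -/
theorem exists_betaMap_glue : ∃ κ : StoneCech (glue C a b ha hb).carrier →
      range (gluing a b), Continuous κ ∧ (∀ t, (κ (stoneCechUnit t)).1 = t.1) ∧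
      ∀ p, (κ ((glue C a b ha hb).betaMap p)).1 = gluing a b p := by
  have : CompactSpace (range (gluing a b)) :=
    isCompact_iff_compactSpace.1 (isCompact_range continuous_gluing)
  let ι : (glue C a b ha hb).carrier → range (gluing a b) :=
    inclusion (image_subset_range (gluing a b) (betaImage X ∪ C))
  have hc : Continuous ι := continuous_inclusion _
  refine ⟨stoneCechExtend hc, continuous_stoneCechExtend hc, fun t => ?_, fun p => ?_⟩
  · rw [stoneCechExtend_stoneCechUnit]
  · refine congrFun (denseRange_stoneCechUnit.equalizer (g := fun p =>
      (stoneCechExtend hc ((glue C a b ha hb).betaMap p)).1) ?_ continuous_gluing ?_) p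
    · exact continuous_subtype_val.comp ((continuous_stoneCechExtend hc).comp
        (Extension.continuous_betaMap _))
    · funext x
      simp only [Function.comp_apply, Extension.betaMap_unit]
      rw [stoneCechExtend_stoneCechUnit]
      rfl

/-- The map `κ` embeds the glued space, so a point of its Stone–Čech compactification lying over a
point of that space is the point itself. -/
theorem betaMap_glue {p : StoneCech X} (hp : p ∈ betaImage X ∪ C) :
    (glue C a b ha hb).betaMap p = stoneCechUnit
      (⟨gluing a b p, mem_image_of_mem _ hp⟩ : (glue C a b ha hb).carrier) := by
  obtain ⟨κ, hκ, h1, h2⟩ := exists_betaMap_glue (C := C) (ha := ha) (hb := hb)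
  exact eq_of_map_eq_of_isInducing (κ := fun w => (κ w).1)
    (j := fun t : (glue C a b ha hb).carrier => t.1) denseRange_stoneCechUnit
    continuous_stoneCechUnit (continuous_subtype_val.comp hκ) IsInducing.subtypeVal h1 (h2 p)

theorem core_glue (hC : C ⊆ (betaImage X)ᶜ) (hab : a ∈ C ↔ b ∈ C) :
    (glue C a b ha hb).core = C := by
  ext p
  constructor
  · rintro ⟨⟨_, q, hq, rfl⟩, ht, htp⟩
    obtain ⟨κ, hκ, h1, h2⟩ := exists_betaMap_glue (C := C) (ha := ha) (hb := hb)
    have hqp : gluing a b q = gluing a b p := by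
      rw [← h2 p, ← htp]
      exact (h1 (⟨gluing a b q, mem_image_of_mem _ hq⟩ : (glue C a b ha hb).carrier)).symm
    exact (gluing_mem_image_iff hab).1 ⟨q, (mem_remainder_glue hC hab q hq).1 ht, hqp⟩
  · intro hp
    exact ⟨_, (mem_remainder_glue hC hab p (Or.inr hp)).2 hp, (betaMap_glue (Or.inr hp)).symm⟩

/-- Having `a` and `b` in `C` puts their common image in the extension itself, where `betaMap_glue`
computes both values. -/
theorem betaMap_glue_eq_iff (haC : a ∈ C) (hbC : b ∈ C) {p q : StoneCech X} :
    (glue C a b ha hb).betaMap p = (glue C a b ha hb).betaMap q ↔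
      p = q ∨ (p = a ∧ q = b) ∨ (p = b ∧ q = a) := by
  constructor
  · intro h
    obtain ⟨κ, hκ, h1, h2⟩ := exists_betaMap_glue (C := C) (ha := ha) (hb := hb)
    rw [← gluing_eq_iff, ← h2 p, ← h2 q, h]
  · have hab : (glue C a b ha hb).betaMap a = (glue C a b ha hb).betaMap b := by
      rw [betaMap_glue (Or.inr haC), betaMap_glue (Or.inr hbC)]
      congr 2
      exact gluing_left_eq_right
    rintro (rfl | ⟨rfl, rfl⟩ | ⟨rfl, rfl⟩)
    · rfl
    · exact hab
    · exact hab.symm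

end Gluing

/-! ### Cores and identifications for elements of ℛ(X) -/

section Order

variable {X : Type u} [TopologicalSpace X]

/-- A representative of an element of `ℛ(X)`. -/
noncomputable def rep (x : realcompactifications X) : Extension X :=
  x.2.choose

theorem mk_rep (x : realcompactifications X) : x.1 = Quotient.mk _ (rep x) :=
  x.2.choose_spec.1

theorem isRealcompact_rep (x : realcompactifications X) : IsRealcompact (rep x).carrier :=
  x.2.choose_spec.2.1

theorem isCompact_remainder_rep (x : realcompactifications X) : IsCompact (rep x).remainder :=
  x.2.choose_spec.2.2

/-- The points of `βX` which are sent to the remainder of the realcompactification `x`. -/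
def core (x : realcompactifications X) : Set (StoneCech X) :=
  (rep x).core

/-- The realcompactification `x` identifies the points `p` and `q` of `βX`. -/
def Glues (x : realcompactifications X) (p q : StoneCech X) : Prop :=
  (rep x).betaMap p = (rep x).betaMap q

theorem le_iff {x y : realcompactifications X} :
    x ≤ y ↔ core y ⊆ core x ∧ ∀ p q, p ≠ q → Glues y p q → Glues x p q := by
  have h : x ≤ y ↔ Extension.LE (rep x) (rep y) := by
    rw [← Subtype.coe_le_coe, mk_rep x, mk_rep y]
    rfl
  rw [h, Extension.LE_iff]
  refine and_congr_right fun _ => ⟨fun h p q _ => h p q, fun h p q hpq => ?_⟩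
  by_cases hne : p = q
  · rw [hne]
  · exact h p q hne hpq

theorem isClosed_core (x : realcompactifications X) : IsClosed (core x) :=
  Extension.isClosed_core (isCompact_remainder_rep x)

theorem clUpsilonDiff_subset_core (x : realcompactifications X) : clUpsilonDiff X ⊆ core x :=
  Extension.clUpsilonDiff_subset_core (isRealcompact_rep x) (isCompact_remainder_rep x)

theorem core_subset_compl (x : realcompactifications X) : core x ⊆ (betaImage X)ᶜ :=
  Extension.core_subset_compl

theorem Glues.symm {x : realcompactifications X} {p q : StoneCech X} (h : Glues x p q) :
    Glues x q p :=
  Eq.symm h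

theorem Glues.mem_core [LocallyCompactSpace X] {x : realcompactifications X} {p q : StoneCech X}
    (h : Glues x p q) (hpq : p ≠ q) : p ∈ core x :=
  Extension.mem_core_of_betaMap_eq (isCompact_remainder_rep x) h hpq

theorem isClosed_insert_clUpsilonDiff (p : StoneCech X) :
    IsClosed (insert p (clUpsilonDiff X)) :=
  isClosed_singleton.union isClosed_closure

variable [T35Space X]

/-- The case `a = b` is allowed and gives X ∪ C with nothing identified. -/
theorem exists_realcompactification {C : Set (StoneCech X)} (hC : C ⊆ (betaImage X)ᶜ)
    (hCc : IsClosed C) (hL : clUpsilonDiff X ⊆ C) {a b : StoneCech X} (ha : a ∈ C) (hb : b ∈ C) :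
    ∃ x : realcompactifications X, core x = C ∧
      ∀ p q, p ≠ q → (Glues x p q ↔ (p = a ∧ q = b) ∨ (p = b ∧ q = a)) := by
  have hab : a ∈ C ↔ b ∈ C := iff_of_true ha hb
  let T := glue C a b (hC ha) (hC hb)
  let x : realcompactifications X := ⟨Quotient.mk _ T, T, rfl,
    isRealcompact_glue hL ha hb hCc, isCompact_remainder_glue hC hCc hab⟩
  -- The chosen representative is only equivalent to `T`, but `LE_iff` in both directions transfers
  -- the core and the identifications.
  have he : Extension.Equivalent T (rep x) := Quotient.exact (mk_rep x)
  have h1 := Extension.LE_iff.1 he.le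
  have h2 := Extension.LE_iff.1 he.ge
  refine ⟨x, (h1.1.antisymm h2.1).trans (core_glue hC hab), fun p q hpq => ?_⟩
  refine Iff.trans ⟨h1.2 p q, h2.2 p q⟩ ((betaMap_glue_eq_iff ha hb).trans ?_)
  exact or_iff_right hpq

variable (X) in
theorem clUpsilonDiff_subset_compl [LocallyCompactSpace X] :
    clUpsilonDiff X ⊆ (betaImage X)ᶜ :=
  closure_minimal (fun _ h => h.2)
    (isOpen_range_of_isDenseEmbedding isDenseEmbedding_stoneCechUnit).isClosed_compl

/-- Otherwise X = υX, which is realcompact. -/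
theorem clUpsilonDiff_nonempty (hX : ¬ IsRealcompact X) : (clUpsilonDiff X).Nonempty := by
  rw [clUpsilonDiff, closure_nonempty_iff, nonempty_iff_ne_empty]
  intro h
  have hu : upsilon X = betaImage X := (sdiff_eq_bot_iff.1 h).antisymm betaImage_subset_upsilon
  obtain ⟨ι, e, he⟩ := isRealcompact_upsilon X
  let k : X → upsilon X := fun x => ⟨stoneCechUnit x, betaImage_subset_upsilon ⟨x, rfl⟩⟩
  have hk : IsEmbedding k :=
    IsEmbedding.of_comp (continuous_stoneCechUnit.subtype_mk _) continuous_subtype_val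
      isEmbedding_stoneCechUnit
  have hs : range k = univ := by
    rw [range_eq_univ]
    rintro ⟨p, hp⟩
    obtain ⟨x, rfl⟩ := hu.subset hp
    exact ⟨x, rfl⟩
  exact hX ⟨ι, e ∘ k, he.comp ⟨hk, hs ▸ isClosed_univ⟩⟩

/-- Coatoms of a partial order with a greatest element. -/
def IsSubmaximal {P : Type*} [Preorder P] (α : P) : Prop :=
  ¬ IsMax α ∧ ∀ β, α < β → IsMax β

/-- The order-theoretic description of the realcompactifications of `X` which add a single point
to the greatest one: those coatoms which are the only coatom above some strictly smaller
element. -/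
def IsPointLike {P : Type*} [Preorder P] (α : P) : Prop :=
  IsSubmaximal α ∧ ∃ x < α, ∀ β, IsSubmaximal β → x ≤ β → β = α

theorem IsSubmaximal.map {P Q : Type*} [Preorder P] [Preorder Q] (e : P ≃o Q) {α : P}
    (h : IsSubmaximal α) : IsSubmaximal (e α) := by
  refine ⟨fun hm => h.1 (e.isMax_apply.1 hm), fun β hβ => ?_⟩
  rw [← e.symm.isMax_apply]
  exact h.2 _ (e.lt_symm_apply.2 hβ)

theorem IsPointLike.map {P Q : Type*} [Preorder P] [Preorder Q] (e : P ≃o Q) {α : P}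
    (h : IsPointLike α) : IsPointLike (e α) := by
  obtain ⟨hα, x, hx, hu⟩ := h
  refine ⟨hα.map e, e x, e.lt_iff_lt.2 hx, fun β hβ hxβ => ?_⟩
  rw [← hu _ (hβ.map e.symm) (e.le_symm_apply.2 hxβ), e.apply_symm_apply]

/-- An extension of the form `X ∪ C ⊆ βX` without identifications. -/
theorem exists_realcompactification_subspace (hX : ¬ IsRealcompact X) {C : Set (StoneCech X)}
    (hC : C ⊆ (betaImage X)ᶜ) (hCc : IsClosed C) (hL : clUpsilonDiff X ⊆ C) :
    ∃ x : realcompactifications X, core x = C ∧ ∀ p q, p ≠ q → ¬ Glues x p q := by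
  obtain ⟨a, ha⟩ := clUpsilonDiff_nonempty hX
  obtain ⟨x, hx, hg⟩ := exists_realcompactification hC hCc hL (hL ha) (hL ha)
  refine ⟨x, hx, fun p q hpq h => hpq ?_⟩
  rcases (hg p q hpq).1 h with ⟨rfl, rfl⟩ | ⟨rfl, rfl⟩ <;> rfl

/-! ### Coatoms of ℛ(X) and the topology of the outer remainder -/

variable [LocallyCompactSpace X]

theorem isMax_iff (hX : ¬ IsRealcompact X) {x : realcompactifications X} :
    IsMax x ↔ core x ⊆ clUpsilonDiff X ∧ ∀ p q, p ≠ q → ¬ Glues x p q := by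
  constructor
  · intro h
    obtain ⟨t, ht, hg⟩ := exists_realcompactification_subspace hX
      (clUpsilonDiff_subset_compl X) isClosed_closure subset_rfl
    have htx := le_iff.1 (h (le_iff.2 ⟨ht ▸ clUpsilonDiff_subset_core x,
      fun p q hpq hp => absurd hp (hg p q hpq)⟩))
    exact ⟨ht ▸ htx.1, fun p q hpq hp => hg p q hpq (htx.2 p q hpq hp)⟩
  · rintro ⟨hc, hg⟩ y -
    exact le_iff.2 ⟨hc.trans (clUpsilonDiff_subset_core y),
      fun p q hpq hp => absurd hp (hg p q hpq)⟩

theorem exists_point (hX : ¬ IsRealcompact X) (p : outerRemainder X) :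
    ∃ x : realcompactifications X, core x = insert p.1 (clUpsilonDiff X) ∧
      ∀ p q, p ≠ q → ¬ Glues x p q :=
  exists_realcompactification_subspace hX
    (insert_subset p.2.1 (clUpsilonDiff_subset_compl X))
    (isClosed_insert_clUpsilonDiff _) (subset_insert _ _)

/-- The realcompactification which adds the point `p` to the greatest one. -/
noncomputable def point (hX : ¬ IsRealcompact X) (p : outerRemainder X) :
    realcompactifications X :=
  (exists_point hX p).choose

variable (hX : ¬ IsRealcompact X)

theorem core_point (p : outerRemainder X) :
    core (point hX p) = insert p.1 (clUpsilonDiff X) :=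
  (exists_point hX p).choose_spec.1

theorem not_glues_point (p : outerRemainder X) {q r : StoneCech X} (h : q ≠ r) :
    ¬ Glues (point hX p) q r :=
  (exists_point hX p).choose_spec.2 q r h

/-- With no identifications in `point hX p` and L in every core, `p` is all that remains to compare.
-/
theorem le_point_iff {p : outerRemainder X} {x : realcompactifications X} :
    x ≤ point hX p ↔ p.1 ∈ core x := by
  rw [le_iff, core_point]
  constructor
  · exact fun h => h.1 (mem_insert _ _)
  · exact fun h => ⟨insert_subset h (clUpsilonDiff_subset_core x),
      fun q r hqr hg => absurd hg (not_glues_point hX p hqr)⟩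

theorem point_injective : Function.Injective (point hX) := by
  intro p q h
  have hq : q.1 ∈ core (point hX p) := (le_point_iff hX).1 h.le
  rw [core_point] at hq
  exact Subtype.ext (hq.resolve_right q.2.2).symm

theorem not_isMax_point (p : outerRemainder X) : ¬ IsMax (point hX p) := by
  intro h
  refine p.2.2 (((isMax_iff hX).1 h).1 ?_)
  rw [core_point]
  exact mem_insert _ _

/-- A realcompactification whose core has a point outside the smallest possible one lies below
the corresponding `point`. -/
theorem exists_le_point {x : realcompactifications X} (h : ¬ core x ⊆ clUpsilonDiff X) :
    ∃ p, x ≤ point hX p := by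
  obtain ⟨p, hp, hpL⟩ := not_subset.1 h
  exact ⟨⟨p, core_subset_compl x hp, hpL⟩, (le_point_iff hX).2 hp⟩

theorem eq_point_of_le {p : outerRemainder X} {α : realcompactifications X}
    (hα : IsSubmaximal α) (h : α ≤ point hX p) : α = point hX p :=
  h.eq_of_not_lt fun hlt => not_isMax_point hX p (hα.2 _ hlt)

theorem isSubmaximal_point (p : outerRemainder X) : IsSubmaximal (point hX p) := by
  refine ⟨not_isMax_point hX p, fun β hβ => (isMax_iff hX).2 ⟨fun q hq => ?_, ?_⟩⟩
  · have h := (le_iff.1 hβ.le).1 hq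
    rw [core_point] at h
    refine h.resolve_left ?_
    rintro rfl
    exact hβ.not_ge ((le_point_iff hX).2 hq)
  · exact fun q r hqr hg => not_glues_point hX p hqr ((le_iff.1 hβ.le).2 q r hqr hg)

theorem isPointLike_point (hX : ¬ IsRealcompact X) (p : outerRemainder X) :
    IsPointLike (point hX p) := by
  refine ⟨isSubmaximal_point hX p, ?_⟩
  obtain ⟨a, ha⟩ := clUpsilonDiff_nonempty hX
  have hpa : p.1 ≠ a := fun h => p.2.2 (h ▸ ha)
  -- The witness glues `p` to a point `a` of L. A coatom above it whose core omits `p` could not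
  -- glue this pair, and would be the greatest element.
  obtain ⟨x, hx, hg⟩ := exists_realcompactification
    (insert_subset p.2.1 (clUpsilonDiff_subset_compl X))
    (isClosed_insert_clUpsilonDiff _) (subset_insert _ _) (mem_insert p.1 _)
    (mem_insert_of_mem p.1 ha)
  have hle : x ≤ point hX p := (le_point_iff hX).2 (hx ▸ mem_insert _ _)
  refine ⟨x, hle.lt_of_not_ge fun h => ?_, fun β hβ hxβ => ?_⟩
  · exact not_glues_point hX p hpa ((le_iff.1 h).2 _ _ hpa ((hg _ _ hpa).2 (Or.inl ⟨rfl, rfl⟩)))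
  · refine eq_point_of_le hX hβ ((le_point_iff hX).2 ?_)
    by_contra hp
    refine hβ.1 ((isMax_iff hX).2 ⟨fun q hq => ?_, fun q r hqr hqg => hp ?_⟩)
    · have h := (le_iff.1 hxβ).1 hq
      rw [hx] at h
      exact h.resolve_left fun h => hp (h ▸ hq)
    · rcases (hg q r hqr).1 ((le_iff.1 hxβ).2 q r hqr hqg) with ⟨rfl, -⟩ | ⟨-, rfl⟩
      · exact hqg.mem_core hqr
      · exact hqg.symm.mem_core hqr.symm

/-- The coatom obtained by identifying two points of the smallest possible core. -/
theorem exists_isSubmaximal_glues (hX : ¬ IsRealcompact X) {c d : StoneCech X}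
    (hc : c ∈ clUpsilonDiff X) (hd : d ∈ clUpsilonDiff X) (hcd : c ≠ d) :
    ∃ τ : realcompactifications X, IsSubmaximal τ ∧ core τ = clUpsilonDiff X ∧
      ∀ p q, p ≠ q → (Glues τ p q ↔ (p = c ∧ q = d) ∨ (p = d ∧ q = c)) := by
  obtain ⟨τ, hτ, hg⟩ := exists_realcompactification
    (clUpsilonDiff_subset_compl X) isClosed_closure subset_rfl hc hd
  refine ⟨τ, ⟨fun h => ?_, fun β hβ => ?_⟩, hτ, hg⟩
  · exact ((isMax_iff hX).1 h).2 c d hcd ((hg c d hcd).2 (Or.inl ⟨rfl, rfl⟩))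
  · have h := le_iff.1 hβ.le
    rw [hτ] at h
    have hn : ¬ Glues β c d := by
      refine fun hβg => hβ.not_ge (le_iff.2 ⟨hτ ▸ clUpsilonDiff_subset_core β, ?_⟩)
      intro p q hpq hpg
      rcases (hg p q hpq).1 hpg with ⟨rfl, rfl⟩ | ⟨rfl, rfl⟩
      · exact hβg
      · exact hβg.symm
    refine (isMax_iff hX).2 ⟨h.1, fun p q hpq hpg => hn ?_⟩
    rcases (hg p q hpq).1 (h.2 p q hpq hpg) with ⟨rfl, rfl⟩ | ⟨rfl, rfl⟩
    · exact hpg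
    · exact hpg.symm

/-- A realcompactification with the smallest possible core lies below the coatom identifying any
given two points which it identifies. -/
theorem exists_isSubmaximal_ge (hX : ¬ IsRealcompact X) {x : realcompactifications X}
    (hx : core x ⊆ clUpsilonDiff X)
    {c d : StoneCech X} (hcd : c ≠ d) (h : Glues x c d) :
    ∃ τ : realcompactifications X, IsSubmaximal τ ∧ x ≤ τ ∧ core τ = clUpsilonDiff X ∧
      ∀ p q, p ≠ q → (Glues τ p q ↔ (p = c ∧ q = d) ∨ (p = d ∧ q = c)) := by
  obtain ⟨τ, hτ, hc, hg⟩ := exists_isSubmaximal_glues hX (hx (h.mem_core hcd))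
    (hx (h.symm.mem_core hcd.symm)) hcd
  refine ⟨τ, hτ, le_iff.2 ⟨hc ▸ clUpsilonDiff_subset_core x, fun p q hpq hpg => ?_⟩, hc, hg⟩
  rcases (hg p q hpq).1 hpg with ⟨rfl, rfl⟩ | ⟨rfl, rfl⟩
  · exact h
  · exact h.symm

/-- If the core of the witness leaves L, some `point` lies above it and must be `α`. Otherwise the
witness glues a pair that `α` does not, and gluing that pair alone gives a second coatom above it.
-/
theorem exists_eq_point {α : realcompactifications X} (h : IsPointLike α) :
    ∃ p, point hX p = α := by
  obtain ⟨hα, x, hx, hu⟩ := h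
  by_contra! hne
  have hcx : core x ⊆ clUpsilonDiff X := by
    by_contra hcx
    obtain ⟨p, hp⟩ := exists_le_point hX hcx
    exact hne p (hu _ (isSubmaximal_point hX p) hp)
  have hgx : ∃ c d, c ≠ d ∧ Glues x c d ∧ ¬ Glues α c d := by
    by_contra! hn
    exact hx.not_ge (le_iff.2 ⟨hcx.trans (clUpsilonDiff_subset_core α), hn⟩)
  obtain ⟨c, d, hcd, hg, hgα⟩ := hgx
  obtain ⟨τ, hτ, hxτ, -, hgτ⟩ := exists_isSubmaximal_ge hX hcx hcd hg
  rw [← hu τ hτ hxτ] at hgα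
  exact hgα ((hgτ c d hcd).2 (Or.inl ⟨rfl, rfl⟩))

theorem isClosed_outerRemainder_iff {F : Set (outerRemainder X)} :
    IsClosed F ↔ ∃ x : realcompactifications X, F = {p | x ≤ point hX p} := by
  constructor
  · intro hF
    obtain ⟨K, hK, rfl⟩ := isClosed_induced_iff.1 hF
    have hR : IsClosed (betaImage X)ᶜ :=
      (isOpen_range_of_isDenseEmbedding isDenseEmbedding_stoneCechUnit).isClosed_compl
    obtain ⟨x, hx, -⟩ := exists_realcompactification_subspace hX
      (C := (K ∩ (betaImage X)ᶜ) ∪ clUpsilonDiff X)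
      (union_subset inter_subset_right (clUpsilonDiff_subset_compl X))
      ((hK.inter hR).union isClosed_closure) subset_union_right
    refine ⟨x, Set.ext fun p => ?_⟩
    rw [mem_ofPred_eq, le_point_iff, hx]
    exact ⟨fun h => Or.inl ⟨h, p.2.1⟩, fun h => (h.resolve_right p.2.2).1⟩
  · rintro ⟨x, rfl⟩
    simp only [le_point_iff]
    exact (isClosed_core x).preimage continuous_subtype_val

end Order

/-! ### Transport along an order isomorphism -/

section Comparison

variable {X : Type u} {Y : Type v} [TopologicalSpace X] [TopologicalSpace Y]
  [T35Space X] [T35Space Y] [LocallyCompactSpace X] [LocallyCompactSpace Y]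

theorem exists_point_eq (hX : ¬ IsRealcompact X) (hY : ¬ IsRealcompact Y)
    (e : realcompactifications X ≃o realcompactifications Y) (p : outerRemainder X) :
    ∃ q : outerRemainder Y, point hY q = e (point hX p) :=
  exists_eq_point hY ((isPointLike_point hX p).map e)

theorem continuous_of_point_eq (hX : ¬ IsRealcompact X) (hY : ¬ IsRealcompact Y)
    (e : realcompactifications X ≃o realcompactifications Y)
    {f : outerRemainder X → outerRemainder Y} (hf : ∀ p, point hY (f p) = e (point hX p)) :
    Continuous f := by
  refine continuous_iff_isClosed.2 fun F hF => ?_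
  obtain ⟨y, rfl⟩ := (isClosed_outerRemainder_iff hY).1 hF
  refine (isClosed_outerRemainder_iff hX).2 ⟨e.symm y, Set.ext fun p => ?_⟩
  simp only [mem_preimage, mem_ofPred_eq, hf, e.symm_apply_le]

end Comparison

end CompactRemainder

theorem mainTheorem4 {X : Type u} {Y : Type v} [TopologicalSpace X] [TopologicalSpace Y]
    [T35Space X] [T35Space Y] [LocallyCompactSpace X] [LocallyCompactSpace Y]
    (hX : ¬ CompactRemainder.IsRealcompact X) (hY : ¬ CompactRemainder.IsRealcompact Y)
    (h : Nonempty (CompactRemainder.realcompactifications X ≃o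
      CompactRemainder.realcompactifications Y)) :
    Nonempty (CompactRemainder.outerRemainder X ≃ₜ CompactRemainder.outerRemainder Y) := by
  obtain ⟨e⟩ := h
  choose f hf using CompactRemainder.exists_point_eq hX hY e
  choose g hg using CompactRemainder.exists_point_eq hY hX e.symm
  exact ⟨{
    toFun := f
    invFun := g
    left_inv := fun p => CompactRemainder.point_injective hX (by
      rw [hg, hf, e.symm_apply_apply])
    right_inv := fun q => CompactRemainder.point_injective hY (by
      rw [hf, hg, e.apply_symm_apply])
    continuous_toFun := CompactRemainder.continuous_of_point_eq hX hY e hf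
    continuous_invFun := CompactRemainder.continuous_of_point_eq hY hX e.symm hg }⟩
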